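/- Let $V$ be a finite-dimensional vector space over a field $k$, let $A$ be a finite set of linear hyperplanes in $V$, and let $B=L(A)$ be its intersection lattice: the set of all intersections of members of $A$ (the empty intersection being $V$), ordered by reverse inclusion, with minimum $\mathbf 0=V$ and maximum $\mathbf 1=\bigcap_{a\in A}a$. Suppose that $B$ is Boolean, i.e. isomorphic to the lattice of subsets of a finite set, and that its rank $rk(B)$, the supremum of the lengths of chains from $\mathbf 0$ to $\mathbf 1$, is at least $2$. Let $F$ be the natural sheaf on $B$: the contravariant functor from $B$ to $k$-vector spaces with $F(x)=x$ whose structure map $F_x^y:F(y)\to F(x)$, for $x\le y$, is the inclusion $y\hookrightarrow x$. Let $\widetilde H_*(B\setminus\mathbf 0;F)$ be the homology of the augmented complex $$\cdots\to S_1\xrightarrow{\,d\,} S_0\xrightarrow{\,\varepsilon\,}F(\mathbf 0)\to 0,\qquad S_n=\bigoplus_{\sigma=(x_n\le\cdots\le x_0)}F(x_0),$$ where $\sigma$ runs over the weakly increasing chains in $B\setminus\mathbf 0$, where $F(\mathbf 0)$ is in degree $-1$, where, for $s\in F(x_0)$ placed in the summand indexed by $\sigma$, $d(s_\sigma)=F_{x_1}^{x_0}(s)_{d_0\sigma}+\sum_{i=1}^n(-1)^i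 s_{d_i\sigma}$ with $d_i\sigma$ obtained from $\sigma$ by omitting $x_i$, and where $\varepsilon$ is the sum of the structure maps $F_{\mathbf 0}^{x}$, $x\in B\setminus\mathbf 0$. Then $$\widetilde H_i(B\setminus\mathbf 0;F)=0\quad\text{for every integer } i.$$ -/

import Mathlib

open CategoryTheory

universe u v

noncomputable section

namespace PosetSheaf

/-- A weakly decreasing chain `x₀ ≥ x₁ ≥ ⋯ ≥ xₙ` in `P`, i.e. an `n`-simplex
(possibly degenerate) of the nerve of `P`. -/
def Chain (P : Type v) [PartialOrder P] (n : ℕ) : Type v :=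
  {x : Fin (n + 1) → P // Antitone x}

/-- The chain `x ∘ θ`, for `θ` weakly increasing. For `θ = Fin.succAbove i` this is the face
`x₀ ≥ ⋯ ≥ x̂ᵢ ≥ ⋯ ≥ xₙ`. -/
def Chain.comp {P : Type v} [PartialOrder P] {m n : ℕ} (σ : Chain P n)
    (θ : Fin (m + 1) →o Fin (n + 1)) : Chain P m :=
  ⟨fun i => σ.1 (θ i), fun _ _ h => σ.2 (θ.monotone h)⟩

/-- The first (largest) entry `x₀` of the chain. -/
def Chain.first {P : Type v} [PartialOrder P] {n : ℕ} (σ : Chain P n) : P := σ.1 0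

theorem Chain.first_comp_le {P : Type v} [PartialOrder P] {m n : ℕ} (σ : Chain P n)
    (θ : Fin (m + 1) →o Fin (n + 1)) : (σ.comp θ).first ≤ σ.first :=
  σ.2 (Fin.zero_le _)

variable {R : Type u} [CommRing R] {P : Type v} [PartialOrder P]

/-- The structure map `F(y) → F(x)`, for `x ≤ y`, of a sheaf (contravariant functor from the
poset `P` to `R`-modules). -/
def structureMap (F : Pᵒᵖ ⥤ ModuleCat.{v} R) {x y : P} (h : x ≤ y) :
    F.obj (Opposite.op y) →ₗ[R] F.obj (Opposite.op x) :=
  (F.map (homOfLE h).op).hom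

theorem structureMap_refl (F : Pᵒᵖ ⥤ ModuleCat.{v} R) {x : P} (h : x ≤ x) :
    structureMap F h = LinearMap.id := by
  have : (homOfLE h).op = 𝟙 (Opposite.op x) := rfl
  rw [structureMap, this, F.map_id, ModuleCat.hom_id]

theorem structureMap_trans (F : Pᵒᵖ ⥤ ModuleCat.{v} R) {x y z : P} (h : x ≤ y) (h' : y ≤ z)
    (s : F.obj (Opposite.op z)) :
    structureMap F h (structureMap F h' s) = structureMap F (h.trans h') s := by
  have : (homOfLE (h.trans h')).op = (homOfLE h').op ≫ (homOfLE h).op := rfl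
  simp only [structureMap]
  rw [this, F.map_comp, ModuleCat.hom_comp, LinearMap.comp_apply]

open Classical in
/-- `Sₙ(P;F)`: the direct sum of the modules `F(x₀)` over all chains `x₀ ≥ ⋯ ≥ xₙ`. -/
abbrev ChainModule (F : Pᵒᵖ ⥤ ModuleCat.{v} R) (n : ℕ) : Type v :=
  DirectSum (Chain P n) (fun σ => F.obj (Opposite.op σ.first))

open Classical in
/-- The element `s_σ` of `Sₙ(P;F)`, with value `s` in the component `σ` and `0` elsewhere. -/
def single (F : Pᵒᵖ ⥤ ModuleCat.{v} R) {n : ℕ} (σ : Chain P n) :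
    F.obj (Opposite.op σ.first) →ₗ[R] ChainModule F n :=
  DirectSum.lof R (Chain P n) (fun σ => F.obj (Opposite.op σ.first)) σ

open Classical in
/-- The linear map out of `Sₙ(P;F)` with the given values on the summands. -/
def lift (F : Pᵒᵖ ⥤ ModuleCat.{v} R) {n : ℕ} {M : Type v} [AddCommGroup M] [Module R M]
    (f : (σ : Chain P n) → F.obj (Opposite.op σ.first) →ₗ[R] M) : ChainModule F n →ₗ[R] M :=
  DirectSum.toModule R (Chain P n) M f

theorem lift_single (F : Pᵒᵖ ⥤ ModuleCat.{v} R) {n : ℕ} {M : Type v} [AddCommGroup M]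
    [Module R M] (f : (σ : Chain P n) → F.obj (Opposite.op σ.first) →ₗ[R] M)
    (σ : Chain P n) (s : F.obj (Opposite.op σ.first)) :
    lift F f (single F σ s) = f σ s := by
  classical exact DirectSum.toModule_lof (M := fun σ : Chain P n =>
    (F.obj (Opposite.op σ.first) : Type v)) (φ := f) R σ s

theorem hom_ext (F : Pᵒᵖ ⥤ ModuleCat.{v} R) {n : ℕ} {M : Type v} [AddCommGroup M]
    [Module R M] {f g : ChainModule F n →ₗ[R] M}
    (h : ∀ σ s, f (single F σ s) = g (single F σ s)) : f = g := by
  classical exact DirectSum.linearMap_ext R fun σ => LinearMap.ext fun s => h σ s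

/-- The map `Sₙ(P;F) → Sₘ(P;F)` induced by `θ : [m] → [n]`: it sends `s_σ` to `s'_τ`, where
`τ = σ ∘ θ` and `s'` is the image of `s` under the structure map
`F(x₀) → F(x_{θ(0)})`. If `θ(0) = 0` this structure map is the identity. -/
def pull (F : Pᵒᵖ ⥤ ModuleCat.{v} R) {m n : ℕ} (θ : Fin (m + 1) →o Fin (n + 1)) :
    ChainModule F n →ₗ[R] ChainModule F m :=
  lift F fun σ => single F (σ.comp θ) ∘ₗ structureMap F (σ.first_comp_le θ)

theorem pull_single (F : Pᵒᵖ ⥤ ModuleCat.{v} R) {m n : ℕ} (θ : Fin (m + 1) →o Fin (n + 1))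
    (σ : Chain P n) (s : F.obj (Opposite.op σ.first)) :
    pull F θ (single F σ s)
      = single F (σ.comp θ) (structureMap F (σ.first_comp_le θ) s) :=
  lift_single F _ σ s

/-- The simplicial `R`-module with `n`-simplices `Sₙ(P;F)`. -/
def simplicialModule (F : Pᵒᵖ ⥤ ModuleCat.{v} R) : SimplicialObject (ModuleCat.{v} R) where
  obj n := ModuleCat.of R (ChainModule F n.unop.len)
  map θ := ModuleCat.ofHom (pull F θ.unop.toOrderHom)
  map_id n := by
    refine ModuleCat.hom_ext (hom_ext F fun σ s => ?_)
    refine (pull_single F _ σ s).trans ?_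
    exact congrArg (single F σ) (LinearMap.congr_fun (structureMap_refl F le_rfl) s)
  map_comp θ η := by
    refine ModuleCat.hom_ext (hom_ext F fun σ s => ?_)
    refine (pull_single F _ σ s).trans ?_
    refine Eq.trans ?_ (congrArg (pull F η.unop.toOrderHom)
      (pull_single F θ.unop.toOrderHom σ s)).symm
    refine Eq.trans ?_ (pull_single F _ _ _).symm
    exact congrArg (single F _) (structureMap_trans F _ _ s).symm

/-- The differential `Sₙ₊₁(P;F) → Sₙ(P;F)`, the alternating sum of the maps induced by the
face maps `dᵢ`; see `differential_single`. -/
def differential (F : Pᵒᵖ ⥤ ModuleCat.{v} R) (n : ℕ) :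
    ChainModule F (n + 1) →ₗ[R] ChainModule F n :=
  ∑ i : Fin (n + 2), (-1 : ℤ) ^ (i : ℕ) • pull F (Fin.succAboveOrderEmb i).toOrderHom

/-- If `dᵢσ` is `σ` with `xᵢ` omitted, then `d(s_σ) = ∑ᵢ (-1)ⁱ (F(x₀ → (dᵢσ)₀) s)_{dᵢσ}`.
The structure map occurring here is `F(x₀) → F(x₁)` for `i = 0`, and the identity of `F(x₀)`
for `i > 0`. -/
theorem differential_single (F : Pᵒᵖ ⥤ ModuleCat.{v} R) (n : ℕ) (σ : Chain P (n + 1))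
    (s : F.obj (Opposite.op σ.first)) :
    differential F n (single F σ s)
      = ∑ i : Fin (n + 2), (-1 : ℤ) ^ (i : ℕ) •
          single F (σ.comp (Fin.succAboveOrderEmb i).toOrderHom)
            (structureMap F (σ.first_comp_le _) s) := by
  rw [differential, LinearMap.sum_apply]
  refine Finset.sum_congr rfl fun i _ => ?_
  rw [LinearMap.smul_apply, pull_single]

theorem differential_eq (F : Pᵒᵖ ⥤ ModuleCat.{v} R) (n : ℕ) :
    ModuleCat.ofHom (differential F n)
      = AlgebraicTopology.AlternatingFaceMapComplex.objD (simplicialModule F) n := by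
  have h : AlgebraicTopology.AlternatingFaceMapComplex.objD (simplicialModule F) n
      = ∑ i : Fin (n + 2), (-1 : ℤ) ^ (i : ℕ) • (ModuleCat.ofHom
          (pull F (Fin.succAboveOrderEmb i).toOrderHom) :
          ModuleCat.of R (ChainModule F (n + 1)) ⟶ ModuleCat.of R (ChainModule F n)) := rfl
  rw [h]
  refine ModuleCat.hom_ext ?_
  rw [ModuleCat.hom_sum]
  rfl

theorem differential_comp (F : Pᵒᵖ ⥤ ModuleCat.{v} R) (n : ℕ) :
    ModuleCat.ofHom (differential F (n + 1)) ≫ ModuleCat.ofHom (differential F n) = 0 := by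
  rw [differential_eq, differential_eq]
  exact AlgebraicTopology.AlternatingFaceMapComplex.d_squared (simplicialModule F) n

/-- The chain complex `S_*(P;F)`. -/
def complex (F : Pᵒᵖ ⥤ ModuleCat.{v} R) : ChainComplex (ModuleCat.{v} R) ℕ :=
  ChainComplex.of (fun n => ModuleCat.of R (ChainModule F n))
    (fun n => ModuleCat.ofHom (differential F n)) (differential_comp F)

theorem complex_d (F : Pᵒᵖ ⥤ ModuleCat.{v} R) (n : ℕ) :
    (complex F).d (n + 1) n = ModuleCat.ofHom (differential F n) :=
  ChainComplex.of_d (fun n => ModuleCat.of R (ChainModule F n))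
    (fun n => ModuleCat.ofHom (differential F n)) n

variable [OrderBot P]

variable (P) in
/-- The poset `P ∖ 0`. -/
abbrev Punctured : Type v := {x : P // x ≠ ⊥}

/-- The restriction of the sheaf `F` to `P ∖ 0`. -/
def restrictPunctured (F : Pᵒᵖ ⥤ ModuleCat.{v} R) : (Punctured P)ᵒᵖ ⥤ ModuleCat.{v} R :=
  (Subtype.mono_coe (fun x : P => x ≠ ⊥)).functor.op ⋙ F

/-- The augmentation `ε : S₀(P ∖ 0; F) → F(0)`, the sum of the structure maps `F(x) → F(0)`. -/
def augmentation (F : Pᵒᵖ ⥤ ModuleCat.{v} R) :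
    ChainModule (restrictPunctured F) 0 →ₗ[R] F.obj (Opposite.op ⊥) :=
  lift (restrictPunctured F) fun σ =>
    structureMap F (bot_le : (⊥ : P) ≤ (σ.first : Punctured P).1)

theorem augmentation_differential (F : Pᵒᵖ ⥤ ModuleCat.{v} R) :
    augmentation F ∘ₗ differential (restrictPunctured F) 0 = 0 := by
  refine hom_ext (restrictPunctured F) fun σ s => ?_
  have key : ∀ i : Fin 2, augmentation F (single (restrictPunctured F)
      (σ.comp (Fin.succAboveOrderEmb i).toOrderHom)
      (structureMap (restrictPunctured F) (σ.first_comp_le _) s))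
      = structureMap F (bot_le : (⊥ : P) ≤ (σ.first : Punctured P).1) s := fun i =>
    (lift_single (restrictPunctured F) _ _ _).trans
      (structureMap_trans F bot_le (σ.first_comp_le (Fin.succAboveOrderEmb i).toOrderHom) s)
  rw [LinearMap.comp_apply, differential_single, map_sum, Fin.sum_univ_two, map_zsmul,
    map_zsmul, key, key]
  simp

theorem d_comp_augmentation (F : Pᵒᵖ ⥤ ModuleCat.{v} R) :
    (complex (restrictPunctured F)).d 1 0 ≫ ModuleCat.ofHom (augmentation F) = 0 := by
  rw [complex_d (restrictPunctured F) 0]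
  exact ModuleCat.hom_ext (augmentation_differential F)

/-- The augmented complex `⋯ → S₁(P ∖ 0; F) → S₀(P ∖ 0; F) → F(0) → 0`, with
`F(0)` placed at index `0` and `Sₙ(P ∖ 0; F)` placed at index `n + 1`. -/
def augmentedComplex (F : Pᵒᵖ ⥤ ModuleCat.{v} R) : ChainComplex (ModuleCat.{v} R) ℕ :=
  (complex (restrictPunctured F)).augment (ModuleCat.ofHom (augmentation F))
    (d_comp_augmentation F)

/-- The reduced homology `H̃ᵢ(P ∖ 0; F)`, for every integer `i`: the homology of the augmented
complex, in which `F(0)` has degree `-1` and `Sₙ(P ∖ 0; F)` has degree `n`. -/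
def reducedHomology (F : Pᵒᵖ ⥤ ModuleCat.{v} R) : ℤ → ModuleCat.{v} R
  | Int.ofNat n => (augmentedComplex F).homology (n + 1)
  | Int.negSucc 0 => (augmentedComplex F).homology 0
  | Int.negSucc (_ + 1) => ModuleCat.of R PUnit

end PosetSheaf

/-- The rank of a poset with minimum and maximum: the supremum of the lengths of chains ending
at the maximum. -/
def posetRank (P : Type v) [PartialOrder P] [BoundedOrder P] : ℕ∞ := Order.height (⊤ : P)

/-- `P` is a (finite) Boolean lattice: it is isomorphic to the lattice of subsets of a finite
set. -/
def IsBooleanLattice (P : Type v) [PartialOrder P] : Prop :=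
  ∃ n : ℕ, Nonempty (P ≃o Set (Fin n))

/-- A (linear) hyperplane arrangement in `V`: a finite set of linear subspaces of
codimension one. -/
structure HyperplaneArrangement (k : Type u) (V : Type v) [Field k] [AddCommGroup V]
    [Module k V] where
  hyperplanes : Finset (Submodule k V)
  codim_eq_one : ∀ H ∈ hyperplanes, Module.finrank k (V ⧸ H) = 1

namespace HyperplaneArrangement

variable {k : Type u} {V : Type v} [Field k] [AddCommGroup V] [Module k V]

/-- The intersection lattice: all intersections of hyperplanes of the arrangement (the empty
intersection being `V`), ordered by reverse inclusion. -/
abbrev IntersectionLattice (A : HyperplaneArrangement k V) : Type v :=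
  {x : (Submodule k V)ᵒᵈ //
    ∃ S ⊆ A.hyperplanes, OrderDual.ofDual x = sInf (S : Set (Submodule k V))}

/-- The subspace of `V` underlying an element of the intersection lattice. -/
def IntersectionLattice.toSubmodule {A : HyperplaneArrangement k V}
    (x : A.IntersectionLattice) : Submodule k V := OrderDual.ofDual x.1

theorem IntersectionLattice.le_iff {A : HyperplaneArrangement k V}
    {x y : A.IntersectionLattice} : x ≤ y ↔ y.toSubmodule ≤ x.toSubmodule := Iff.rfl

/-- The minimum is `V`, the maximum is the intersection of all the hyperplanes. -/
instance (A : HyperplaneArrangement k V) : BoundedOrder A.IntersectionLattice where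
  bot := ⟨OrderDual.toDual ⊤, ∅, by simp, by simp⟩
  bot_le x := IntersectionLattice.le_iff.2 le_top
  top := ⟨OrderDual.toDual (sInf (A.hyperplanes : Set (Submodule k V))), A.hyperplanes,
    subset_rfl, rfl⟩
  le_top := by
    rintro ⟨x, S, hS, hx⟩
    refine IntersectionLattice.le_iff.2 (le_trans (sInf_le_sInf ?_) hx.ge)
    exact_mod_cast hS

/-- The natural sheaf on the intersection lattice: `F(x)` is the subspace `x` itself, and for
`x ≤ y` the structure map `F(y) → F(x)` is the inclusion. -/
def naturalSheaf (A : HyperplaneArrangement k V) :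
    A.IntersectionLatticeᵒᵖ ⥤ ModuleCat.{v} k where
  obj x := ModuleCat.of k x.unop.toSubmodule
  map f := ModuleCat.ofHom (Submodule.inclusion (IntersectionLattice.le_iff.1 f.unop.le))

end HyperplaneArrangement

end

/-! The reduced complex is contracted by coning chains off to several apexes at once. In a Boolean
arrangement each hyperplane `H` misses some vector `w_H` lying in all the other hyperplanes. If
`φ_H` has kernel `H` and `φ_H(w_H) = 1`, the maps `v ↦ φ_H(v) w_H` together with their complement in
the identity split `F(0) = V` into pieces `q_j`. Each piece has values in some `c_j`, the
intersection of all hyperplanes or of all but one, and `c_j ≠ 0` in the lattice because the rank is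
at least 2. The key property is that `q_j` kills `F(x)` unless `x ≤ c_j` (`component_eq_zero`).
Hence `s_σ ↦ ∑_j (q_j s)_(c_j, σ)`, over those `j` with `σ` below `c_j`, is well defined, and `∑_j
q_j = id` makes it a contracting homotopy (`differential_prepend_add_prepend_differential`,
`sum_localize_restrictBot`). `isZero_reducedHomology` states this for any sheaf admitting such a
splitting. -/

noncomputable section

namespace PosetSheaf

/-! ### Coning chains off to a single apex -/

section Prepend

variable {R : Type u} [CommRing R] {P : Type v} [PartialOrder P]

/-- The chain `c ≥ x₀ ≥ ⋯ ≥ xₙ`. -/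
def Chain.cons {n : ℕ} (c : P) (σ : Chain P n) (h : σ.first ≤ c) : Chain P (n + 1) :=
  ⟨Fin.cons c σ.1, by
    intro i j hij
    induction j using Fin.cases with
    | zero => rw [Fin.le_zero_iff.1 hij]
    | succ j =>
      induction i using Fin.cases with
      | zero => exact (σ.2 (Fin.zero_le j)).trans h
      | succ i => exact σ.2 (Fin.succ_le_succ_iff.1 hij)⟩

theorem Chain.cons_comp_zero {n : ℕ} (c : P) (σ : Chain P n) (h : σ.first ≤ c) :
    (σ.cons c h).comp (Fin.succAboveOrderEmb 0).toOrderHom = σ :=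
  Subtype.ext <| funext fun i => by
    change (Fin.cons c σ.1 : Fin (n + 2) → P) (Fin.succAbove 0 i) = σ.1 i
    rw [Fin.succAbove_zero, Fin.cons_succ]

theorem Chain.cons_comp_succ {n : ℕ} (c : P) (σ : Chain P (n + 1)) (h : σ.first ≤ c)
    (i : Fin (n + 2)) :
    (σ.cons c h).comp (Fin.succAboveOrderEmb i.succ).toOrderHom
      = (σ.comp (Fin.succAboveOrderEmb i).toOrderHom).cons c ((σ.first_comp_le _).trans h) :=
  Subtype.ext <| funext fun j => by
    change (Fin.cons c σ.1 : Fin (n + 3) → P) (Fin.succAbove i.succ j)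
      = (Fin.cons c (fun j => σ.1 (Fin.succAbove i j)) : Fin (n + 2) → P) j
    induction j using Fin.cases with
    | zero => simp
    | succ j => simp

/-- The chain with the single entry `c`. -/
def Chain.point (c : P) : Chain P 0 := ⟨fun _ => c, fun _ _ _ => le_rfl⟩

theorem Chain.eq_of_first_eq {σ τ : Chain P 0} (h : σ.first = τ.first) : σ = τ :=
  Subtype.ext <| funext fun i => by
    obtain rfl : i = 0 := Fin.fin_one_eq_zero i
    exact h

/-- The module of coefficients depends on the chain; a structure map between equal endpoints
replaces a cast. -/
theorem single_congr (F : Pᵒᵖ ⥤ ModuleCat.{v} R) {n : ℕ} {σ τ : Chain P n} (h : σ = τ)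
    (s : F.obj (Opposite.op σ.first)) (h' : τ.first ≤ σ.first) :
    single F σ s = single F τ (structureMap F h' s) := by
  subst h
  rw [structureMap_refl, LinearMap.id_apply]

variable (F : Pᵒᵖ ⥤ ModuleCat.{v} R) (c : P)
  (q : ∀ x : P, F.obj (Opposite.op x) →ₗ[R] F.obj (Opposite.op c))

/-- The element `t_(c, σ)` of `Sₙ₊₁(P;F)`, for `t` in `F(c)`. -/
def singleCons {n : ℕ} (σ : Chain P n) (h : σ.first ≤ c) :
    F.obj (Opposite.op c) →ₗ[R] ChainModule F (n + 1) :=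
  single F (σ.cons c h)

/-- The element `t_c` of `S₀(P;F)`, for `t` in `F(c)`. -/
def singlePoint : F.obj (Opposite.op c) →ₗ[R] ChainModule F 0 :=
  single F (Chain.point c)

open Classical in
/-- The composite `F(x) → F(c) → F(x)` of `q x` and the structure map, when `x ≤ c`. -/
def localize (x : P) : F.obj (Opposite.op x) →ₗ[R] F.obj (Opposite.op x) :=
  if h : x ≤ c then structureMap F h ∘ₗ q x else 0

open Classical in
/-- The map sending `s_σ` to `(q s)_{(c, σ)}` if the chain `σ` lies below `c`, and to `0`
otherwise. -/
def prepend (n : ℕ) : ChainModule F n →ₗ[R] ChainModule F (n + 1) :=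
  lift F fun σ => if h : σ.first ≤ c then singleCons F c σ h ∘ₗ q σ.first else 0

variable {F c}

theorem prepend_single_of_le {n : ℕ} (σ : Chain P n) (s : F.obj (Opposite.op σ.first))
    (h : σ.first ≤ c) :
    prepend F c q n (single F σ s) = singleCons F c σ h (q σ.first s) := by
  rw [prepend, lift_single, dif_pos h]
  rfl

theorem prepend_single_of_not_le {n : ℕ} (σ : Chain P n) (s : F.obj (Opposite.op σ.first))
    (h : ¬ σ.first ≤ c) : prepend F c q n (single F σ s) = 0 := by
  rw [prepend, lift_single, dif_neg h]
  rfl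

theorem differential_single_cons {n : ℕ} (σ : Chain P (n + 1)) (h : σ.first ≤ c)
    (t : F.obj (Opposite.op c)) :
    differential F (n + 1) (singleCons F c σ h t)
      = single F σ (structureMap F h t) - ∑ i : Fin (n + 2), (-1 : ℤ) ^ (i : ℕ) •
        singleCons F c (σ.comp (Fin.succAboveOrderEmb i).toOrderHom)
          ((σ.first_comp_le _).trans h) t := by
  refine (differential_single F _ (σ.cons c h) t).trans ?_
  rw [Fin.sum_univ_succ, sub_eq_add_neg, ← Finset.sum_neg_distrib]
  congr 1
  · rw [Fin.val_zero, pow_zero, one_smul, single_congr F (σ.cons_comp_zero c h) _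
      (le_of_eq (congrArg Chain.first (σ.cons_comp_zero c h)).symm)]
    exact congrArg _ (structureMap_trans F _ _ t)
  · refine Finset.sum_congr rfl fun i _ => ?_
    rw [Fin.val_succ, pow_succ, mul_neg_one, neg_smul,
      single_congr F (σ.cons_comp_succ c h i) _
        (le_of_eq (congrArg Chain.first (σ.cons_comp_succ c h i)).symm)]
    refine congrArg (fun z => -((-1 : ℤ) ^ (i : ℕ) • single F _ z)) ?_
    refine (structureMap_trans F _ _ t).trans ?_
    exact LinearMap.congr_fun (structureMap_refl F le_rfl) t

/-- The usual cone identity: omitting `c` returns `σ`, and the other faces of `(c, σ)` cancel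
against the cones over the faces of `σ`. -/
theorem differential_prepend_add_prepend_differential
    (hq : ∀ {x y : P} (h : x ≤ y) (s : F.obj (Opposite.op y)),
      q x (structureMap F h s) = q y s)
    (hq0 : ∀ x : P, ¬ x ≤ c → q x = 0) {n : ℕ} (σ : Chain P (n + 1))
    (s : F.obj (Opposite.op σ.first)) :
    differential F (n + 1) (prepend F c q (n + 1) (single F σ s))
      + prepend F c q n (differential F n (single F σ s))
      = single F σ (localize F c q σ.first s) := by
  rw [differential_single, map_sum]
  by_cases h : σ.first ≤ c
  · rw [prepend_single_of_le q σ s h, differential_single_cons, localize, dif_pos h]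
    refine (sub_add_eq_add_sub _ _ _).trans (sub_eq_of_eq_add ?_)
    refine congrArg₂ _ rfl (Finset.sum_congr rfl fun i _ => ?_)
    rw [map_zsmul, prepend_single_of_le q _ _ ((σ.first_comp_le _).trans h), hq]
  · rw [prepend_single_of_not_le q σ s h, localize, dif_neg h, map_zero, zero_add,
      LinearMap.zero_apply, map_zero]
    refine Finset.sum_eq_zero fun i _ => ?_
    rw [map_zsmul]
    -- A face omitting `x₀` may lie below `c` although `σ` does not; its cone vanishes because `q`
    -- already kills `F(x₀)`.
    by_cases h' : (σ.comp (Fin.succAboveOrderEmb i).toOrderHom).first ≤ c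
    · rw [prepend_single_of_le q _ _ h', hq, hq0 _ h, LinearMap.zero_apply, map_zero, smul_zero]
    · rw [prepend_single_of_not_le q _ _ h', smul_zero]

/-- In degree zero, the differential of `(q s)_{(c, x)}` is `(q s)_x - (q s)_c`. -/
theorem differential_prepend_zero (hq0 : ∀ x : P, ¬ x ≤ c → q x = 0) (σ : Chain P 0)
    (s : F.obj (Opposite.op σ.first)) :
    differential F 0 (prepend F c q 0 (single F σ s))
      = single F σ (localize F c q σ.first s) - singlePoint F c (q σ.first s) := by
  by_cases h : σ.first ≤ c
  · rw [prepend_single_of_le q σ s h, localize, dif_pos h]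
    refine (differential_single F _ (σ.cons c h) _).trans ?_
    rw [Fin.sum_univ_two, Fin.val_zero, pow_zero, one_smul, Fin.val_one, pow_one, neg_one_smul,
      ← sub_eq_add_neg]
    have h0 : (σ.cons c h).comp (Fin.succAboveOrderEmb 0).toOrderHom = σ :=
      σ.cons_comp_zero c h
    have h1 : (σ.cons c h).comp (Fin.succAboveOrderEmb 1).toOrderHom = Chain.point c :=
      Chain.eq_of_first_eq rfl
    refine congrArg₂ _ ?_ ?_
    · refine (single_congr F h0 _ (le_of_eq (congrArg Chain.first h0).symm)).trans ?_
      exact congrArg _ (structureMap_trans F _ _ _)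
    · refine (single_congr F h1 _ (le_of_eq (congrArg Chain.first h1).symm)).trans ?_
      refine congrArg (single F (Chain.point c)) ((structureMap_trans F _ _ _).trans ?_)
      exact LinearMap.congr_fun (structureMap_refl F le_rfl) _
  · rw [prepend_single_of_not_le q σ s h, localize, dif_neg h, hq0 _ h]
    simp

end Prepend

/-! ### Contracting homotopy from a splitting of `F(0)` -/

section Contraction

variable {R : Type u} [CommRing R] {P : Type v} [PartialOrder P] [OrderBot P]
  {F : Pᵒᵖ ⥤ ModuleCat.{v} R} {J : Type*} (c : J → Punctured P)
  (q : ∀ j, F.obj (Opposite.op ⊥) →ₗ[R] F.obj (Opposite.op (c j).1))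

/-- The composite of `q` with the structure map `F(x) → F(0)`. -/
def restrictBot {c : Punctured P} (q : F.obj (Opposite.op ⊥) →ₗ[R] F.obj (Opposite.op c.1))
    (x : Punctured P) :
    (restrictPunctured F).obj (Opposite.op x) →ₗ[R]
      (restrictPunctured F).obj (Opposite.op c) :=
  q ∘ₗ structureMap F (bot_le : ⊥ ≤ x.1)

theorem restrictBot_structureMap {c : Punctured P}
    (q : F.obj (Opposite.op ⊥) →ₗ[R] F.obj (Opposite.op c.1)) {x y : Punctured P} (h : x ≤ y)
    (s : (restrictPunctured F).obj (Opposite.op y)) :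
    restrictBot q x (structureMap (restrictPunctured F) h s) = restrictBot q y s :=
  congrArg q (structureMap_trans F bot_le (show x.1 ≤ y.1 from h) s)

/-- The element `(q s)_c` of `S₀(P ∖ 0;F)`, for `s` in `F(0)`. -/
def singleOfBot {c : Punctured P} (q : F.obj (Opposite.op ⊥) →ₗ[R] F.obj (Opposite.op c.1)) :
    F.obj (Opposite.op ⊥) →ₗ[R] ChainModule (restrictPunctured F) 0 :=
  singlePoint (restrictPunctured F) c ∘ₗ q

variable (hinj : ∀ x : P, Function.Injective (structureMap F (bot_le : ⊥ ≤ x)))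
  (hq0 : ∀ j (x : P), ¬ x ≤ (c j).1 → ∀ s, q j (structureMap F (bot_le : ⊥ ≤ x) s) = 0)

include hq0 in
theorem restrictBot_eq_zero (j : J) (x : Punctured P) (h : ¬ x ≤ c j) :
    restrictBot (q j) x = 0 :=
  LinearMap.ext fun s => hq0 j x.1 h s

variable [Fintype J]
  (hsum : ∀ s, ∑ j, structureMap F (bot_le : ⊥ ≤ (c j).1) (q j s) = s)

-- Injectivity of `F(x) → F(0)` lets the identity be tested in `F(0)`. There it is `hsum`, since the
-- terms dropped by `localize` are zero by `hq0`.
include hinj hq0 hsum in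
theorem sum_localize_restrictBot (x : Punctured P)
    (s : (restrictPunctured F).obj (Opposite.op x)) :
    ∑ j, localize (restrictPunctured F) (c j) (restrictBot (q j)) x s = s := by
  refine hinj x.1 ?_
  refine Eq.trans (map_sum (structureMap F (bot_le : ⊥ ≤ x.1)) _ _) ?_
  refine Eq.trans (Finset.sum_congr rfl fun j _ => ?_)
    (hsum (structureMap F (bot_le : ⊥ ≤ x.1) s))
  by_cases h : x ≤ c j
  · rw [localize, dif_pos h]
    exact structureMap_trans F bot_le (show x.1 ≤ (c j).1 from h) _
  · rw [localize, dif_neg h, hq0 j x.1 h s, map_zero]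
    exact map_zero _

include hinj hq0 hsum in
theorem exists_differential_eq {n : ℕ} (z : ChainModule (restrictPunctured F) (n + 1))
    (hz : differential (restrictPunctured F) n z = 0) :
    ∃ w, differential (restrictPunctured F) (n + 1) w = z := by
  have key : ∑ j, (differential (restrictPunctured F) (n + 1) ∘ₗ
        prepend (restrictPunctured F) (c j) (restrictBot (q j)) (n + 1)
      + prepend (restrictPunctured F) (c j) (restrictBot (q j)) n ∘ₗ
        differential (restrictPunctured F) n) = LinearMap.id := by
    refine hom_ext _ fun σ s => ?_
    rw [LinearMap.sum_apply, LinearMap.id_apply]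
    refine Eq.trans (Finset.sum_congr rfl fun j _ =>
      differential_prepend_add_prepend_differential (restrictBot (q j))
        (restrictBot_structureMap (q j)) (restrictBot_eq_zero c q hq0 j) σ s) ?_
    rw [← map_sum, sum_localize_restrictBot c q hinj hq0 hsum]
  refine ⟨∑ j, prepend (restrictPunctured F) (c j) (restrictBot (q j)) (n + 1) z, ?_⟩
  have hkey := LinearMap.congr_fun key z
  rw [LinearMap.sum_apply, LinearMap.id_apply] at hkey
  -- This expands `z` inside `prepend` as well; the last `hkey` below folds it back.
  rw [map_sum, ← hkey]
  refine Finset.sum_congr rfl fun j _ => ?_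
  rw [LinearMap.add_apply, LinearMap.comp_apply, LinearMap.comp_apply, hz, map_zero, add_zero,
    hkey]

-- In degree 0 the cone leaves an extra term `-(q s)_c`, which `singleOfBot (q j)` after the
-- augmentation cancels.
include hinj hq0 hsum in
theorem exists_differential_eq_of_augmentation_eq_zero
    (z : ChainModule (restrictPunctured F) 0) (hz : augmentation F z = 0) :
    ∃ w, differential (restrictPunctured F) 0 w = z := by
  have key : ∑ j, (differential (restrictPunctured F) 0 ∘ₗ
        prepend (restrictPunctured F) (c j) (restrictBot (q j)) 0
      + singleOfBot (q j) ∘ₗ augmentation F)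
      = LinearMap.id := by
    refine hom_ext _ fun σ s => ?_
    rw [LinearMap.sum_apply, LinearMap.id_apply]
    refine Eq.trans (Finset.sum_congr rfl fun j _ => ?_)
      ((map_sum (single (restrictPunctured F) σ) _ _).symm.trans
        (congrArg _ (sum_localize_restrictBot c q hinj hq0 hsum σ.first s)))
    have haug : augmentation F (single (restrictPunctured F) σ s)
        = structureMap F (bot_le : (⊥ : P) ≤ (σ.first : Punctured P).1) s :=
      lift_single (restrictPunctured F) _ σ s
    rw [LinearMap.add_apply, LinearMap.comp_apply,
      differential_prepend_zero (restrictBot (q j)) (restrictBot_eq_zero c q hq0 j) σ s,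
      LinearMap.comp_apply, haug]
    exact sub_add_cancel _ _
  refine ⟨∑ j, prepend (restrictPunctured F) (c j) (restrictBot (q j)) 0 z, ?_⟩
  have hkey := LinearMap.congr_fun key z
  rw [LinearMap.sum_apply, LinearMap.id_apply] at hkey
  rw [map_sum, ← hkey]
  refine Finset.sum_congr rfl fun j _ => ?_
  rw [LinearMap.add_apply, LinearMap.comp_apply, LinearMap.comp_apply, hz, map_zero, add_zero,
    hkey]

include hsum in
theorem augmentation_surjective : Function.Surjective (augmentation F) := fun s => by
  refine ⟨∑ j, singlePoint (restrictPunctured F) (c j) (q j s), ?_⟩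
  rw [map_sum]
  refine Eq.trans (Finset.sum_congr rfl fun j _ => ?_) (hsum s)
  exact lift_single (restrictPunctured F) _ (Chain.point (c j)) (q j s)

include hinj hq0 hsum in
/-- If `F(0)` splits into pieces supported below proper elements `c j` of `P`, compatibly with
the subobjects `F(x)`, then all reduced homology of `P ∖ 0` vanishes. -/
theorem isZero_reducedHomology (i : ℤ) : Limits.IsZero (reducedHomology F i) := by
  match i with
  | Int.ofNat 0 =>
    refine (HomologicalComplex.exactAt_iff_isZero_homology _ _).1 ?_
    -- Indices in the augmented complex exceed the homological degree by one.
    rw [HomologicalComplex.exactAt_iff' _ 2 1 0 (by simp) (by simp),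
      ShortComplex.moduleCat_exact_iff]
    intro z hz
    obtain ⟨w, hw⟩ := exists_differential_eq_of_augmentation_eq_zero c q hinj hq0 hsum z hz
    refine ⟨w, Eq.trans ?_ hw⟩
    exact congrArg (fun f => f.hom w) (complex_d (restrictPunctured F) 0)
  | Int.ofNat (n + 1) =>
    refine (HomologicalComplex.exactAt_iff_isZero_homology _ _).1 ?_
    rw [HomologicalComplex.exactAt_iff' _ (n + 3) (n + 2) (n + 1) (by simp) (by simp),
      ShortComplex.moduleCat_exact_iff]
    intro z hz
    obtain ⟨w, hw⟩ := exists_differential_eq c q hinj hq0 hsum (n := n) z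
      (Eq.trans (congrArg (fun f => f.hom z) (complex_d (restrictPunctured F) n)).symm hz)
    refine ⟨w, Eq.trans ?_ hw⟩
    exact congrArg (fun f => f.hom w) (complex_d (restrictPunctured F) (n + 1))
  | Int.negSucc 0 =>
    refine (HomologicalComplex.exactAt_iff_isZero_homology _ _).1 ?_
    -- Index 0 has no successor, so `next` returns 0 itself and the outgoing map is zero: exactness
    -- is surjectivity of the augmentation.
    rw [HomologicalComplex.exactAt_iff' _ 1 0 0 (by simp) (by simp),
      ShortComplex.moduleCat_exact_iff]
    intro z _
    exact augmentation_surjective c q hsum z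
  | Int.negSucc (_ + 1) => exact ModuleCat.isZero_of_subsingleton (ModuleCat.of R PUnit)

end Contraction

end PosetSheaf

/-! ### Boolean arrangements and their hyperplanes -/

namespace HyperplaneArrangement

open PosetSheaf

variable {k : Type u} {V : Type v} [Field k] [AddCommGroup V] [Module k V]
  (A : HyperplaneArrangement k V)

theorem isCoatom_of_mem {H : Submodule k V} (hH : H ∈ A.hyperplanes) : IsCoatom H := by
  have := A.codim_eq_one H hH
  rw [← isSimpleModule_iff_isCoatom, isSimpleModule_iff_finrank_eq_one]
  exact this

/-- A hyperplane which misses `w` is the kernel of a linear form taking the value `1` at `w`. -/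
theorem exists_dual_of_notMem {H : Submodule k V} (hH : H ∈ A.hyperplanes) {w : V}
    (hw : w ∉ H) : ∃ φ : Module.Dual k V, LinearMap.ker φ = H ∧ φ w = 1 := by
  have hfin := A.codim_eq_one H hH
  have : Module.Finite k (V ⧸ H) := Module.finite_of_finrank_eq_succ hfin
  let e : (V ⧸ H) ≃ₗ[k] k := LinearEquiv.ofFinrankEq _ _ (by rw [hfin, Module.finrank_self])
  have hew : e (H.mkQ w) ≠ 0 := by
    rwa [Ne, LinearEquiv.map_eq_zero_iff, Submodule.mkQ_apply, Submodule.Quotient.mk_eq_zero]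
  refine ⟨(e (H.mkQ w))⁻¹ • (e.toLinearMap ∘ₗ H.mkQ), ?_, ?_⟩
  · rw [LinearMap.ker_smul _ _ (inv_ne_zero hew), LinearEquiv.ker_comp, Submodule.ker_mkQ]
  · exact inv_mul_cancel₀ hew

/-- The intersection of a set of members of the arrangement. -/
def inter (S : Finset (Submodule k V)) (hS : S ⊆ A.hyperplanes) : A.IntersectionLattice :=
  ⟨OrderDual.toDual (sInf (S : Set (Submodule k V))), S, hS, rfl⟩

theorem isAtom_inter_singleton {H : Submodule k V} (hH : H ∈ A.hyperplanes) :
    IsAtom (A.inter {H} (by simpa using hH)) := by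
  have hsub : (A.inter {H} (by simpa using hH)).toSubmodule = H := by
    change sInf ((({H} : Finset _)) : Set (Submodule k V)) = H
    simp
  refine ⟨fun h => (A.isCoatom_of_mem hH).1 ?_, fun x hx => Subtype.ext ?_⟩
  · rw [← hsub, h]
    rfl
  · refine (A.isCoatom_of_mem hH).2 x.toSubmodule (lt_of_le_of_ne ?_ fun h => hx.ne ?_)
    · exact hsub ▸ IntersectionLattice.le_iff.1 hx.le
    · exact Subtype.ext (h.symm.trans hsub.symm)

/-- If the intersection lattice is Boolean, no member of the arrangement contains the
intersection of the others. -/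
theorem exists_mem_of_isBooleanLattice
    (hBool : IsBooleanLattice A.IntersectionLattice)
    {H : Submodule k V} (hH : H ∈ A.hyperplanes) :
    ∃ w : V, w ∉ H ∧ ∀ H' ∈ A.hyperplanes, H' ≠ H → w ∈ H' := by
  obtain ⟨n, ⟨e⟩⟩ := hBool
  have hatom : ∀ {K : Submodule k V} (hK : K ∈ A.hyperplanes),
      ∃ i, e (A.inter {K} (by simpa using hK)) = {i} := fun hK =>
    Set.isAtom_iff.1 ((OrderIso.isAtom_iff e _).2 (A.isAtom_inter_singleton hK))
  have hle : ∀ {K : Submodule k V} (hK : K ∈ A.hyperplanes) (x : A.IntersectionLattice),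
      A.inter {K} (by simpa using hK) ≤ x ↔ x.toSubmodule ≤ K := fun {K} hK x => by
    rw [IntersectionLattice.le_iff]
    change _ ≤ sInf ((({K} : Finset _)) : Set (Submodule k V)) ↔ _
    simp
  obtain ⟨i, hi⟩ := hatom hH
  -- The atom of `H` corresponds to `{i}`. The complement of `{i}` lies above every atom except this
  -- one, so its subspace is contained in all the other hyperplanes but not in `H`.
  have hm : ¬ (e.symm {i}ᶜ).toSubmodule ≤ H := by
    rw [← hle hH, ← e.le_iff_le, hi, e.apply_symm_apply]
    simp
  obtain ⟨w, hw, hwH⟩ := SetLike.not_le_iff_exists.1 hm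
  refine ⟨w, hwH, fun H' hH' hne => ?_⟩
  refine (hle hH' (e.symm {i}ᶜ)).1 ?_ hw
  obtain ⟨i', hi'⟩ := hatom hH'
  rw [← e.le_iff_le, hi', e.apply_symm_apply]
  refine Set.singleton_subset_iff.2 ?_
  rintro rfl
  have := congrArg IntersectionLattice.toSubmodule (e.injective (hi'.trans hi.symm))
  exact hne (by simpa [inter, IntersectionLattice.toSubmodule] using this)

/-- With at most one hyperplane the lattice has only the elements `⊥` and `⊤`, whereas rank at least
2 provides one strictly between them. -/
theorem exists_mem_ne_of_two_le_posetRank (hrank : 2 ≤ posetRank A.IntersectionLattice)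
    (H : Submodule k V) : ∃ H' ∈ A.hyperplanes, H' ≠ H := by
  by_contra! hA
  obtain ⟨y, z, hzy, hy⟩ := Order.one_lt_height_iff.1
    (lt_of_lt_of_le (by norm_num) hrank : 1 < Order.height (⊤ : A.IntersectionLattice))
  obtain ⟨S, hS, hyS⟩ := y.2
  rcases S.eq_empty_or_nonempty with rfl | ⟨K, hK⟩
  · have : y = ⊥ := Subtype.ext (hyS.trans (by rw [Finset.coe_empty, sInf_empty]; rfl))
    exact not_lt_bot (this ▸ hzy)
  · have hSA : S = A.hyperplanes := subset_antisymm hS fun K' hK' => by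
      rwa [hA K' hK', ← hA K (hS hK)]
    have : y = ⊤ := Subtype.ext (hyS.trans (by rw [hSA]; rfl))
    exact hy.ne this

theorem inter_ne_bot {S : Finset (Submodule k V)} (hS : S ⊆ A.hyperplanes) (hne : S.Nonempty) :
    A.inter S hS ≠ ⊥ := fun h => by
  obtain ⟨H, hH⟩ := hne
  have htop : sInf (S : Set (Submodule k V)) = ⊤ := congrArg IntersectionLattice.toSubmodule h
  refine (A.isCoatom_of_mem (hS hH)).1 (top_le_iff.1 (htop ▸ sInf_le ?_))
  exact Finset.mem_coe.2 hH

theorem mem_inter {S : Finset (Submodule k V)} (hS : S ⊆ A.hyperplanes) {v : V} :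
    v ∈ (A.inter S hS).toSubmodule ↔ ∀ H ∈ S, v ∈ H :=
  Submodule.mem_sInf

/-! ### The splitting of `V` -/

open Classical in
/-- A maximal proper subset of the arrangement for `some H`, the whole arrangement for
`none`. -/
def subarrangement : Option A.hyperplanes → Finset (Submodule k V)
  | none => A.hyperplanes
  | some H => A.hyperplanes.erase H

theorem subarrangement_subset (j : Option A.hyperplanes) :
    A.subarrangement j ⊆ A.hyperplanes := by
  classical
  cases j with
  | none => exact subset_rfl
  | some H => exact Finset.erase_subset _ _

/-- Ensures that every apex lies in `B ∖ 0`; in rank 1, erasing the only hyperplane would give the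
apex `V = 0`. -/
theorem subarrangement_nonempty (hrank : 2 ≤ posetRank A.IntersectionLattice)
    (j : Option A.hyperplanes) : (A.subarrangement j).Nonempty := by
  classical
  cases j with
  | none =>
    obtain ⟨H, hH, -⟩ := A.exists_mem_ne_of_two_le_posetRank hrank ⊤
    exact ⟨H, hH⟩
  | some H =>
    obtain ⟨H', hH', hne⟩ := A.exists_mem_ne_of_two_le_posetRank hrank H
    exact ⟨H', Finset.mem_erase.2 ⟨hne, hH'⟩⟩

/-- The decomposition `v = (v - ∑ φ_H(v) w_H) + ∑ φ_H(v) w_H`. -/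
def component (φ : A.hyperplanes → Module.Dual k V) (w : A.hyperplanes → V) :
    Option A.hyperplanes → V →ₗ[k] V
  | none => LinearMap.id - ∑ H, (φ H).smulRight (w H)
  | some H => (φ H).smulRight (w H)

variable {A}

theorem sum_component (φ : A.hyperplanes → Module.Dual k V) (w : A.hyperplanes → V) (v : V) :
    ∑ j, A.component φ w j v = v := by
  simp [component, Fintype.sum_option]

variable {φ : A.hyperplanes → Module.Dual k V} {w : A.hyperplanes → V}

/-- The `w_H` are dual to the `φ_H`, so subtracting all `φ_H(v) w_H` from `v` leaves a vector killed
by every `φ_H`. -/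
theorem component_mem (hker : ∀ H, LinearMap.ker (φ H) = H.1) (hone : ∀ H, φ H (w H) = 1)
    (hw : ∀ H : A.hyperplanes, ∀ H' ∈ A.hyperplanes, H' ≠ H.1 → w H ∈ H')
    (j : Option A.hyperplanes) (v : V) :
    A.component φ w j v ∈ (A.inter _ (A.subarrangement_subset j)).toSubmodule := by
  classical
  rw [mem_inter]
  intro H hH
  cases j with
  | none =>
    change v - (∑ K, (φ K).smulRight (w K)) v ∈ H
    have hzero : ∀ K : A.hyperplanes, K ≠ ⟨H, hH⟩ → φ ⟨H, hH⟩ (w K) = 0 := fun K hK => by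
      rw [← LinearMap.mem_ker, hker]
      exact hw K H hH fun h => hK (Subtype.ext h.symm)
    rw [show H = LinearMap.ker (φ ⟨H, hH⟩) from (hker ⟨H, hH⟩).symm, LinearMap.mem_ker, map_sub,
      LinearMap.sum_apply, map_sum, Finset.sum_eq_single ⟨H, hH⟩]
    · simp [hone]
    · intro K _ hK
      simp [hzero K hK]
    · simp
  | some K =>
    obtain ⟨hne, hmem⟩ := Finset.mem_erase.1 hH
    exact H.smul_mem _ (hw K H hmem hne)

/-- Write `x` as the intersection of `S`. If `x` is not below the apex omitting `H`, then `H ∈ S`,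
so `x` lies in the kernel of `φ_H`. The apex for `none` is the maximum, so nothing fails to be below
it. -/
theorem component_eq_zero (hker : ∀ H, LinearMap.ker (φ H) = H.1)
    (j : Option A.hyperplanes) (x : A.IntersectionLattice)
    (hx : ¬ x ≤ A.inter _ (A.subarrangement_subset j)) {v : V} (hv : v ∈ x.toSubmodule) :
    A.component φ w j v = 0 := by
  classical
  obtain ⟨S, hS, hxS⟩ := x.2
  have hnot : ¬ S ⊆ A.subarrangement j := fun h => hx <| IntersectionLattice.le_iff.2 <|
    (sInf_le_sInf (Finset.coe_subset.2 h)).trans hxS.ge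
  cases j with
  | none => exact absurd hS hnot
  | some H =>
    have hHS : H.1 ∈ S := by
      by_contra h
      exact hnot (Finset.subset_erase.2 ⟨hS, h⟩)
    have hvH : v ∈ LinearMap.ker (φ H) := by
      rw [hker]
      exact (hxS.le.trans (sInf_le (Finset.mem_coe.2 hHS))) hv
    change φ H v • w H = 0
    rw [LinearMap.mem_ker.1 hvH, zero_smul]

end HyperplaneArrangement

end

open PosetSheaf HyperplaneArrangement

theorem mainTheorem7 {k : Type u} {V : Type v} [Field k] [AddCommGroup V] [Module k V]
    [FiniteDimensional k V] (A : HyperplaneArrangement k V)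
    (hBool : IsBooleanLattice A.IntersectionLattice)
    (hrank : 2 ≤ posetRank A.IntersectionLattice) (i : ℤ) :
    Limits.IsZero (PosetSheaf.reducedHomology A.naturalSheaf i) := by
  choose w hwH hw using fun H : A.hyperplanes => A.exists_mem_of_isBooleanLattice hBool H.2
  choose φ hker hone using fun H : A.hyperplanes => A.exists_dual_of_notMem H.2 (hwH H)
  -- The remaining goals are injectivity of the inclusions into `V`, vanishing of components away
  -- from their apexes, and the sum of components being the identity.
  refine isZero_reducedHomology (F := A.naturalSheaf)
    (fun j => ⟨A.inter _ (A.subarrangement_subset j),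
      A.inter_ne_bot _ (A.subarrangement_nonempty hrank j)⟩)
    (fun j => (A.component φ w j ∘ₗ Submodule.subtype _).codRestrict _
      fun v => component_mem hker hone hw j v.1)
    ?_ ?_ ?_ i
  · exact fun x => Submodule.inclusion_injective (IntersectionLattice.le_iff.1 (bot_le : ⊥ ≤ x))
  · exact fun j x hx s => Subtype.ext (component_eq_zero hker j x hx s.2)
  · intro s
    refine Subtype.ext ?_
    refine Eq.trans (map_sum (Submodule.subtype _) _ _) ?_
    exact sum_component φ w s.1
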